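/- Let $\mathcal P=(\mathbf x,\mathbf r)$ be a group presentation, where $\mathbf r$ is a subset of the free group $F$ on $\mathbf x$, let $G=F/\langle\langle \mathbf r\rangle\rangle$ be the group it presents, fix $r_0\in\mathbf r$ and put $\mathbf r_1=\mathbf r\setminus\{r_0\}$. Let $Y\cup Y^{-1}$ be the set of formal symbols $({}^{u}r)^{\varepsilon}$ with $u\in F$, $r\in\mathbf r$, $\varepsilon=\pm1$. For such a symbol $a=({}^{u}r)^{\varepsilon}$ put $a^{-1}=({}^{u}r)^{-\varepsilon}$, $\theta(a)=ur^{\varepsilon}u^{-1}\in F$, and ${}^{w}a=({}^{wu}r)^{\varepsilon}$ for $w\in F$. Let $\Upsilon$ be the monoid with generating set $Y\cup Y^{-1}$ and defining relations $ab={}^{\theta(a)}b\,a$ for all $a,b\in Y\cup Y^{-1}$, let $\sigma$ be the canonical homomorphism from the free monoid on $Y\cup Y^{-1}$ onto $\Upsilon$, let $\mathcal G(\Upsilon)$ be the universal enveloping group of $\Upsilon$ (the group given by the same generators and relations), and let $\mu:\Upsilon\to\mathcal G(\Upsilon)$ be the canonical homomorphism. Let $Y_1\cup Y_1^{-1}$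 be the set of those symbols $({}^{u}r)^{\varepsilon}$ with $r\in\mathbf r_1$, and let $\hat{\mathfrak A}_1$ be the subgroup of $\mathcal G(\Upsilon)$ generated by all elements $\mu\sigma(bb^{-1})$ with $b\in Y_1\cup Y_1^{-1}$. If $\mathcal P$ is aspherical, that is, if the geometric realisation $K(\mathcal P)$ of $\mathcal P$ (the 2-dimensional CW-complex with one vertex, one loop for each element of $\mathbf x$, and one 2-cell for each $r\in\mathbf r$, attached along $r$) satisfies $\pi_2(K(\mathcal P))=0$, then $\hat{\mathfrak A}_1$ is a free abelian group with a basis equipotent to the set $G\times\mathbf r_1$. -/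

import Mathlib

universe u

/-! ### The geometric realisation of a group presentation and asphericity

A group presentation is a type `X` of generators together with a set `r` of relators in the free
group on `X`; the group it presents is `PresentedGroup r`. -/

namespace GroupPres

/-- Gluing of the end points of the edges, one for each generator, to a single vertex. -/
inductive GlueOne (X : Type u) :
    Unit ⊕ (Σ _ : X, unitInterval) → Unit ⊕ (Σ _ : X, unitInterval) → Prop
  | source (x : X) : GlueOne X (Sum.inr ⟨x, 0⟩) (Sum.inl ())
  | target (x : X) : GlueOne X (Sum.inr ⟨x, 1⟩) (Sum.inl ())

/-- The 1-skeleton: one vertex and one loop for each generator, with the quotient topology. -/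
abbrev OneSkeleton (X : Type u) : Type u := Quot (GlueOne X)

/-- The vertex of the 1-skeleton. -/
def vertex (X : Type u) : OneSkeleton X := Quot.mk _ (Sum.inl ())

/-- The loop of a generator. -/
def edgeLoop {X : Type u} (x : X) : Path (vertex X) (vertex X) where
  toFun t := Quot.mk _ (Sum.inr ⟨x, t⟩)
  continuous_toFun := by
    exact continuous_quot_mk.comp (continuous_inr.comp continuous_sigmaMk)
  source' := Quot.sound (GlueOne.source x)
  target' := Quot.sound (GlueOne.target x)

/-- The loop spelled by a word; the letter `(x, true)` is the generator `x` and the letter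
`(x, false)` is its inverse. -/
noncomputable def wordLoop {X : Type u} : List (X × Bool) → Path (vertex X) (vertex X)
  | [] => Path.refl _
  | (x, true) :: w => (edgeLoop x).trans (wordLoop w)
  | (x, false) :: w => (edgeLoop x).symm.trans (wordLoop w)

open Classical in
/-- The attaching loop of an element of the free group, spelled by its reduced word. -/
noncomputable def attachLoop {X : Type u} (w : FreeGroup X) : Path (vertex X) (vertex X) :=
  wordLoop w.toWord

/-- Gluing of one closed unit disc for each relator `ρ` to the 1-skeleton: the boundary point
`exp (2 π i t)` is glued to the point with parameter `t` of the attaching loop of `ρ`. -/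
inductive GlueTwo {X : Type u} (r : Set (FreeGroup X)) :
    OneSkeleton X ⊕ (Σ _ : r, Metric.closedBall (0 : ℂ) 1) →
      OneSkeleton X ⊕ (Σ _ : r, Metric.closedBall (0 : ℂ) 1) → Prop
  | glue (ρ : r) (t : unitInterval) (z : Metric.closedBall (0 : ℂ) 1)
      (hz : (z : ℂ) = Complex.exp (2 * Real.pi * Complex.I * ((t : ℝ) : ℂ))) :
      GlueTwo r (Sum.inr ⟨ρ, z⟩) (Sum.inl (attachLoop (ρ : FreeGroup X) t))

/-- The geometric realisation of the presentation, a connected 2-dimensional CW-complex with one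
vertex, a 1-cell for each generator and a 2-cell for each relator. -/
abbrev Realisation {X : Type u} (r : Set (FreeGroup X)) : Type u := Quot (GlueTwo r)

/-- The vertex of the geometric realisation. -/
def baseVertex {X : Type u} (r : Set (FreeGroup X)) : Realisation r :=
  Quot.mk _ (Sum.inl (vertex X))

/-- The presentation is aspherical: the second homotopy group of its geometric realisation
is trivial. -/
def IsAspherical {X : Type u} (r : Set (FreeGroup X)) : Prop :=
  Subsingleton (HomotopyGroup.Pi 2 (Realisation r) (baseVertex r))

/-! ### Universal enveloping groups of monoids given by presentations -/

/-- The inclusion of the free monoid on `A` into the free group on `A`. -/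
def wordToGroup (A : Type u) : FreeMonoid A →* FreeGroup A := FreeMonoid.lift FreeGroup.of

/-- The group relators `u * v⁻¹` coming from the monoid relations `u = v`. -/
def hatRel {A : Type u} (R : FreeMonoid A → FreeMonoid A → Prop) : Set (FreeGroup A) :=
  {w | ∃ p q : FreeMonoid A, R p q ∧ w = wordToGroup A p * (wordToGroup A q)⁻¹}

/-- The universal enveloping group of the monoid `PresentedMonoid R`. -/
abbrev EnvelopingGroup {A : Type u} (R : FreeMonoid A → FreeMonoid A → Prop) : Type u :=
  PresentedGroup (hatRel R)

/-- The canonical homomorphism from a presented monoid to its universal enveloping group; it sends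
the class of a generator to the class of the same generator. -/
def toEnvelopingGroup {A : Type u} (R : FreeMonoid A → FreeMonoid A → Prop) :
    PresentedMonoid R →* EnvelopingGroup R :=
  PresentedMonoid.lift (fun a => (PresentedGroup.of a : EnvelopingGroup R)) (by
    intro p q h
    have key : ∀ w : FreeMonoid A,
        FreeMonoid.lift (fun a => (PresentedGroup.of a : EnvelopingGroup R)) w
          = PresentedGroup.mk (hatRel R) (wordToGroup A w) := by
      intro w
      refine DFunLike.congr_fun (?_ : FreeMonoid.lift _ =
        (PresentedGroup.mk (hatRel R)).comp (wordToGroup A)) w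
      ext a
      simp [wordToGroup, PresentedGroup.of]
    rw [key, key]
    have h1 : PresentedGroup.mk (hatRel R) (wordToGroup A p * (wordToGroup A q)⁻¹) = 1 :=
      PresentedGroup.one_of_mem ⟨p, q, h, rfl⟩
    rwa [map_mul, map_inv, mul_inv_eq_one] at h1)

/-! ### Signed symbols, the monoid `Υ` and its enveloping group -/

/-- The elements of `Y ∪ Y⁻¹`: the formal symbols `(ᵘρ)^ε`, where `u` lies in the free group, `ρ` is
a relator and `ε = ±1`. -/
structure SignedSymbol {X : Type u} (r : Set (FreeGroup X)) : Type u where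
  /-- the element `u` of the free group -/
  conj : FreeGroup X
  /-- the relator `ρ` -/
  rel : r
  /-- the exponent `ε` -/
  sign : ℤˣ

namespace SignedSymbol

variable {X : Type u} {r : Set (FreeGroup X)}

/-- The formal inverse `(ᵘρ)^(-ε)` of the symbol `(ᵘρ)^ε`. -/
def inv (a : SignedSymbol r) : SignedSymbol r := ⟨a.conj, a.rel, -a.sign⟩

/-- `θ ((ᵘρ)^ε) = u ρ^ε u⁻¹`. -/
def theta (a : SignedSymbol r) : FreeGroup X :=
  a.conj * (a.rel : FreeGroup X) ^ (a.sign : ℤ) * a.conj⁻¹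

/-- The action of the free group on symbols, `ʷ((ᵘρ)^ε) = (ʷᵘρ)^ε`. -/
def act (w : FreeGroup X) (a : SignedSymbol r) : SignedSymbol r := ⟨w * a.conj, a.rel, a.sign⟩

end SignedSymbol

/-- The defining relations `a b = (^θ(a) b) a` of the monoid `Υ`. -/
inductive UpsilonRel {X : Type u} (r : Set (FreeGroup X)) :
    FreeMonoid (SignedSymbol r) → FreeMonoid (SignedSymbol r) → Prop
  | exchange (a b : SignedSymbol r) :
      UpsilonRel r (FreeMonoid.of a * FreeMonoid.of b)
        (FreeMonoid.of (SignedSymbol.act a.theta b) * FreeMonoid.of a)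

/-- The monoid `Υ` of a presentation. -/
abbrev Upsilon {X : Type u} (r : Set (FreeGroup X)) : Type u := PresentedMonoid (UpsilonRel r)

/-- The universal enveloping group `𝒢(Υ)`. -/
abbrev GUpsilon {X : Type u} (r : Set (FreeGroup X)) : Type u := EnvelopingGroup (UpsilonRel r)

/-- The canonical homomorphism `σ` from the free monoid on `Y ∪ Y⁻¹` onto `Υ`. -/
def sigma {X : Type u} (r : Set (FreeGroup X)) : FreeMonoid (SignedSymbol r) →* Upsilon r :=
  PresentedMonoid.mk (UpsilonRel r)

/-- The canonical homomorphism `μ` from `Υ` to `𝒢(Υ)`. -/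
def mu {X : Type u} (r : Set (FreeGroup X)) : Upsilon r →* GUpsilon r :=
  toEnvelopingGroup (UpsilonRel r)

/-- The subgroup of `𝒢(Υ)` generated by the elements `μσ(b b⁻¹)`, where `b` runs over the signed
symbols `(ᵘρ)^ε` whose relator `ρ` lies in the subset `r₁` of `r`. -/
def hatA {X : Type u} (r r₁ : Set (FreeGroup X)) : Subgroup (GUpsilon r) :=
  Subgroup.closure {g | ∃ b : SignedSymbol r, (b.rel : FreeGroup X) ∈ r₁ ∧
    g = mu r (sigma r (FreeMonoid.of b * FreeMonoid.of b.inv))}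

end GroupPres

/-! Each product `b b⁻¹` is central in the enveloping group, because `θ(b) θ(b⁻¹) = 1`. Centrality
makes the class of `(ᵘρ)^ε (ᵘρ)^(-ε)` independent of `ε` and dependent on `u` only modulo the normal
closure `N` of `r`, so `G × r₁` indexes a generating set of an abelian group. These generators are
independent: exchange relations permute symbols and change `u` only within its coset modulo `N`, so
counting positive symbols by `(uN, ρ)` is a homomorphism to the free abelian group on `G × r₁`, and
it sends each generator to its own basis element. -/

namespace GroupPres

variable {X : Type u} {r : Set (FreeGroup X)}

/-- The class of a signed symbol in the universal enveloping group of `Υ`. -/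
def symbolClass (a : SignedSymbol r) : GUpsilon r := PresentedGroup.of a

/-- The element `μσ(b b⁻¹)` of the universal enveloping group. -/
def cancelClass (b : SignedSymbol r) : GUpsilon r := symbolClass b * symbolClass b.inv

theorem mu_sigma_of (a : SignedSymbol r) : mu r (sigma r (FreeMonoid.of a)) = symbolClass a := by
  rfl

theorem mu_sigma_cancel (b : SignedSymbol r) :
    mu r (sigma r (FreeMonoid.of b * FreeMonoid.of b.inv)) = cancelClass b := by
  rw [map_mul, map_mul, mu_sigma_of, mu_sigma_of, cancelClass]

theorem symbolClass_exchange (a b : SignedSymbol r) :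
    symbolClass a * symbolClass b = symbolClass (b.act a.theta) * symbolClass a := by
  rw [← mu_sigma_of a, ← mu_sigma_of b, ← mu_sigma_of (b.act a.theta), ← map_mul, ← map_mul,
    ← map_mul, ← map_mul]
  exact congrArg (mu r) (Quotient.sound (ConGen.Rel.of _ _ (UpsilonRel.exchange a b)))

namespace SignedSymbol

theorem inv_inv (b : SignedSymbol r) : b.inv.inv = b := by
  simp [inv]

theorem act_act (v w : FreeGroup X) (b : SignedSymbol r) :
    (b.act w).act v = b.act (v * w) := by
  simp [act, mul_assoc]

theorem act_one (b : SignedSymbol r) : b.act 1 = b := by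
  simp [act]

theorem act_inv (w : FreeGroup X) (b : SignedSymbol r) : (b.act w).inv = b.inv.act w := rfl

theorem theta_mul_theta_inv (b : SignedSymbol r) : b.theta * b.inv.theta = 1 := by
  simp [theta, inv, mul_assoc]

theorem theta_mem_normalClosure (a : SignedSymbol r) : a.theta ∈ Subgroup.normalClosure r :=
  Subgroup.normalClosure_normal.conj_mem _
    (Subgroup.zpow_mem _ (Subgroup.subset_normalClosure a.rel.2) _) _

end SignedSymbol

/-- A symbol carried leftwards past `b⁻¹` and then `b` is acted on by `θ(b) θ(b⁻¹) = 1`, so it comes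
out unchanged. -/
theorem cancelClass_mem_center (b : SignedSymbol r) :
    cancelClass b ∈ Subgroup.center (GUpsilon r) := by
  have commute_symbol (c : SignedSymbol r) :
      symbolClass c ∈ Subgroup.centralizer {cancelClass b} := by
    rw [Subgroup.mem_centralizer_singleton_iff, cancelClass, mul_assoc (symbolClass b),
      symbolClass_exchange b.inv c, ← mul_assoc (symbolClass b),
      symbolClass_exchange b (c.act _), SignedSymbol.act_act, SignedSymbol.theta_mul_theta_inv,
      SignedSymbol.act_one, mul_assoc]
  have top_le : (⊤ : Subgroup (GUpsilon r)) ≤ Subgroup.centralizer {cancelClass b} := by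
    rw [← PresentedGroup.closure_range_of, Subgroup.closure_le]
    rintro _ ⟨c, rfl⟩
    exact commute_symbol c
  rw [Subgroup.mem_center_iff]
  intro g
  exact (Subgroup.mem_centralizer_singleton_iff.mp (top_le (Subgroup.mem_top g)))

/-- Cancel the left factor `b` in `b (b b⁻¹) = (b b⁻¹) b`. -/
theorem cancelClass_inv (b : SignedSymbol r) : cancelClass b.inv = cancelClass b := by
  have central := Subgroup.mem_center_iff.mp (cancelClass_mem_center b) (symbolClass b)
  rw [cancelClass, SignedSymbol.inv_inv]
  rw [cancelClass, mul_assoc] at central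
  exact (mul_left_cancel central).symm

/-- Exchanging `a` with `b b⁻¹` twists both factors by `θ(a)`, while centrality lets `a` pass with
no twist; cancel `a`. -/
theorem cancelClass_act_theta (a b : SignedSymbol r) :
    cancelClass (b.act a.theta) = cancelClass b := by
  have central := Subgroup.mem_center_iff.mp (cancelClass_mem_center b) (symbolClass a)
  have moved : symbolClass a * cancelClass b =
      cancelClass (b.act a.theta) * symbolClass a := by
    rw [cancelClass, cancelClass, ← mul_assoc, symbolClass_exchange a b, mul_assoc,
      symbolClass_exchange a b.inv, ← mul_assoc, SignedSymbol.act_inv]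
  exact mul_right_cancel (moved.symm.trans central)

theorem cancelClass_act_of_mem {n : FreeGroup X} (hn : n ∈ Subgroup.normalClosure r)
    (b : SignedSymbol r) : cancelClass (b.act n) = cancelClass b := by
  induction hn using Subgroup.closure_induction generalizing b with
  | mem x hx =>
    -- A generator `u ρ u⁻¹` of `N` is `θ` of the positive symbol `ᵘρ`.
    obtain ⟨ρ, hρ, hconj⟩ := Group.mem_conjugatesOfSet_iff.mp hx
    obtain ⟨u, rfl⟩ := isConj_iff.mp hconj
    simpa [SignedSymbol.theta] using cancelClass_act_theta ⟨u, ⟨ρ, hρ⟩, 1⟩ b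
  | one => rw [SignedSymbol.act_one]
  | mul x y _ _ hx hy => rw [← SignedSymbol.act_act, hx, hy]
  | inv x _ hx => rw [← hx (b.act x⁻¹), SignedSymbol.act_act, mul_inv_cancel,
      SignedSymbol.act_one]

theorem cancelClass_eq_of_mk_eq {u v : FreeGroup X} (ρ : r) (ε : ℤˣ)
    (huv : PresentedGroup.mk r u = PresentedGroup.mk r v) :
    cancelClass ⟨u, ρ, ε⟩ = cancelClass ⟨v, ρ, 1⟩ := by
  have mem : u * v⁻¹ ∈ Subgroup.normalClosure r := by
    rw [← PresentedGroup.mk_eq_one_iff, map_mul, map_inv, huv, mul_inv_cancel]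
  have sign_one : cancelClass ⟨u, ρ, 1⟩ = cancelClass ⟨v, ρ, 1⟩ := by
    simpa [SignedSymbol.act] using cancelClass_act_of_mem mem ⟨v, ρ, 1⟩
  rcases Int.units_eq_one_or ε with rfl | rfl
  · exact sign_one
  · rw [← sign_one]
    exact cancelClass_inv ⟨u, ρ, 1⟩

open Classical in
/-- The value on signed symbols of the projection `positivePart`: a positive symbol `ᵘρ` with
`ρ ∈ r₁` goes to the basis element `(uN, ρ)`, every other symbol to zero. -/
noncomputable def positiveSymbol (r₁ : Set (FreeGroup X)) (a : SignedSymbol r) :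
    FreeAbelianGroup (PresentedGroup r × r₁) :=
  if h : (a.rel : FreeGroup X) ∈ r₁ ∧ a.sign = 1 then
    FreeAbelianGroup.of (PresentedGroup.mk r a.conj, ⟨a.rel, h.1⟩)
  else 0

theorem positiveSymbol_act (r₁ : Set (FreeGroup X)) {n : FreeGroup X}
    (hn : n ∈ Subgroup.normalClosure r) (a : SignedSymbol r) :
    positiveSymbol r₁ (a.act n) = positiveSymbol r₁ a := by
  have same : PresentedGroup.mk r (n * a.conj) = PresentedGroup.mk r a.conj := by
    rw [map_mul, PresentedGroup.mk_eq_one_iff.mpr hn, one_mul]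
  unfold positiveSymbol SignedSymbol.act
  dsimp only
  rw [same]

/-- The homomorphism from the enveloping group onto the free abelian group on `G × r₁` that counts
the positive symbols with relator in `r₁`. -/
noncomputable def positivePart (r r₁ : Set (FreeGroup X)) :
    GUpsilon r →* Multiplicative (FreeAbelianGroup (PresentedGroup r × r₁)) :=
  PresentedGroup.toGroup (f := fun a => Multiplicative.ofAdd (positiveSymbol r₁ a)) (by
    rintro _ ⟨p, q, ⟨a, b⟩, rfl⟩
    rw [map_mul, map_inv, mul_inv_eq_one]
    simp only [wordToGroup, map_mul, FreeMonoid.lift_eval_of, FreeGroup.lift_apply_of,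
      positiveSymbol_act r₁ a.theta_mem_normalClosure]
    exact mul_comm _ _)

/-- Exactly one of `b`, `b⁻¹` is positive, so either sign contributes the same single basis element.
-/
theorem positivePart_cancelClass (r₁ : Set (FreeGroup X)) (b : SignedSymbol r)
    (hb : (b.rel : FreeGroup X) ∈ r₁) :
    positivePart r r₁ (cancelClass b) = Multiplicative.ofAdd
      (FreeAbelianGroup.of (PresentedGroup.mk r b.conj, (⟨b.rel, hb⟩ : r₁))) := by
  have value (a : SignedSymbol r) :
      positivePart r r₁ (symbolClass a) = Multiplicative.ofAdd (positiveSymbol r₁ a) :=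
    PresentedGroup.toGroup.of _
  rw [cancelClass, map_mul, value, value, ← ofAdd_add]
  obtain ⟨u, ρ, ε⟩ := b
  have hne : (-1 : ℤˣ) ≠ 1 := by decide
  have hρ : (ρ : FreeGroup X) ∈ r₁ := hb
  rcases Int.units_eq_one_or ε with rfl | rfl <;>
    simp [positiveSymbol, SignedSymbol.inv, hρ, hne]

open scoped IsMulCommutative in
/-- The homomorphism from the free abelian group on `G × r₁` to the centre of the enveloping group
that sends `(uN, ρ)` to the class of `(ᵘρ)(ᵘρ)⁻¹`. -/
noncomputable def cancelHom {r₁ : Set (FreeGroup X)} (hr₁ : r₁ ⊆ r) :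
    FreeAbelianGroup (PresentedGroup r × r₁) →+ Additive (Subgroup.center (GUpsilon r)) :=
  FreeAbelianGroup.lift (β := Additive (Subgroup.center (GUpsilon r))) fun p : PresentedGroup r × r₁ => Additive.ofMul
    ⟨cancelClass ⟨Function.surjInv (PresentedGroup.mk_surjective r) p.1, ⟨p.2, hr₁ p.2.2⟩, 1⟩,
      cancelClass_mem_center _⟩

open scoped IsMulCommutative in
theorem cancelHom_of {r₁ : Set (FreeGroup X)} (hr₁ : r₁ ⊆ r) (p : PresentedGroup r × r₁) :
    ((cancelHom hr₁ (FreeAbelianGroup.of p)).toMul : GUpsilon r) =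
      cancelClass ⟨Function.surjInv (PresentedGroup.mk_surjective r) p.1, ⟨p.2, hr₁ p.2.2⟩, 1⟩ :=
  congrArg (fun z : Additive (Subgroup.center (GUpsilon r)) => (z.toMul : GUpsilon r))
    (FreeAbelianGroup.lift_apply_of _ p)

/-- This left inverse gives injectivity of `positivePart` on `hatA`; being multiplicative, it need
only be checked on generators. -/
theorem cancelHom_positivePart {r₁ : Set (FreeGroup X)} (hr₁ : r₁ ⊆ r) {g : GUpsilon r}
    (hg : g ∈ hatA r r₁) :
    ((cancelHom hr₁ (positivePart r r₁ g).toAdd).toMul : GUpsilon r) = g := by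
  induction hg using Subgroup.closure_induction with
  | mem x hx =>
    obtain ⟨b, hb, rfl⟩ := hx
    rw [mu_sigma_cancel, positivePart_cancelClass r₁ b hb, toAdd_ofAdd, cancelHom_of]
    -- The representative chosen by `surjInv` may differ from `b.conj` by an element of `N`, and `b`
    -- may be negative; neither affects the class.
    exact (cancelClass_eq_of_mk_eq b.rel b.sign
      (Function.surjInv_eq (PresentedGroup.mk_surjective r) _).symm).symm
  | one => simp
  | mul x y _ _ hx hy => simp [hx, hy]
  | inv x _ hx => simp [hx]

/-- For `r₁ ⊆ r`, the subgroup generated by the classes of `b b⁻¹` with relator in `r₁` is free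
abelian on `G × r₁`. -/
noncomputable def hatAEquiv {r₁ : Set (FreeGroup X)} (hr₁ : r₁ ⊆ r) :
    Additive (hatA r r₁) ≃+ FreeAbelianGroup (PresentedGroup r × r₁) :=
  AddEquiv.ofBijective (MonoidHom.toAdditiveLeft ((positivePart r r₁).comp (hatA r r₁).subtype)) <| by
    constructor
    · intro x y hxy
      apply Additive.toMul.injective
      apply Subtype.ext
      rw [← cancelHom_positivePart hr₁ x.toMul.2, ← cancelHom_positivePart hr₁ y.toMul.2]
      exact congrArg (fun z => ((cancelHom hr₁ z).toMul : GUpsilon r)) hxy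
    · rw [← AddMonoidHom.range_eq_top, eq_top_iff]
      rintro z -
      induction z using FreeAbelianGroup.induction_on with
      | zero => exact zero_mem _
      | of p =>
        obtain ⟨g, ρ⟩ := p
        obtain ⟨u, rfl⟩ := PresentedGroup.mk_surjective r g
        let b : SignedSymbol r := ⟨u, ⟨ρ, hr₁ ρ.2⟩, 1⟩
        exact ⟨Additive.ofMul ⟨cancelClass b,
          Subgroup.subset_closure ⟨b, ρ.2, (mu_sigma_cancel b).symm⟩⟩,
          congrArg Multiplicative.toAdd (positivePart_cancelClass r₁ b ρ.2)⟩
      | neg p hp => exact neg_mem hp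
      | add x y hx hy => exact add_mem hx hy

end GroupPres

theorem lemma5p1 {X : Type u} (r : Set (FreeGroup X)) (r₀ : FreeGroup X) (hr₀ : r₀ ∈ r)
    (hasph : GroupPres.IsAspherical r) :
    Nonempty (Additive (GroupPres.hatA r (r \ {r₀})) ≃+
      FreeAbelianGroup (PresentedGroup r × (r \ {r₀} : Set (FreeGroup X)))) :=
  ⟨GroupPres.hatAEquiv Set.sdiff_subset⟩
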